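/- Fix a rational $\varepsilon\ge 0$. The formulae of continuous Markovian logic (CML) are given by $\phi::=\top\mid\lnot\phi\mid\phi\land\phi\mid L_r\phi$ with $r\in\mathbb Q_{\ge 0}$; put $\bot=\lnot\top$ and $\phi\to\psi=\lnot(\phi\land\lnot\psi)$. A continuous Markov kernel (CMK) is a triple $\mathcal M=(M,\Sigma,\theta)$ where $M$ is an analytic space (homeomorphic to the image of a continuous map between Polish spaces), $\Sigma$ is its Borel $\sigma$-algebra, and $\theta$ is a measurable map from $M$ to the space of finite measures on $(M,\Sigma)$, which carries the $\sigma$-algebra generated by the evaluations $\mu\mapsto\mu(S)$, $S\in\Sigma$. A continuous Markov process (CMP) is a pair $(\mathcal M,m)$ with $m\in M$; it is finite if $M$ is finite. The $\varepsilon$-satisfaction relation is defined by: $m\models_\varepsilon\top$ always; $m\models_\varepsilon\lnot\phi$ iff not $m\models_\varepsilon\phi$; $m\models_\varepsilon\phi\land\psi$ iff $m\models_\varepsilon\phi$ and $m\models_\varepsilon\psi$; and $m\models_\varepsilon L_r\phi$ iff $\theta(m)(\{n\in M: n\models_\varepsilon\phi\})+\varepsilon\ge r$. The derivability relation $\Phi\vdash_\varepsilon\phi$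 between sets of formulae and formulae is the least relation such that $\Phi\vdash_\varepsilon\phi$ for every $\phi\in\Phi$ and for every instance $\phi$ of a propositional tautology, which is closed under modus ponens and under the deduction rule (if $\Phi\cup\{\phi\}\vdash_\varepsilon\psi$ then $\Phi\vdash_\varepsilon\phi\to\psi$), which contains, for all $\Phi$, all formulae $\phi,\psi$ and all $r,s\in\mathbb Q_{\ge0}$ (with $r+s\ge\varepsilon$ in (A3) and (A4)), * (A1) $\Phi\vdash_\varepsilon L_\varepsilon\phi$; * (A2) $\Phi\vdash_\varepsilon L_{r+s}\phi\to L_r\phi$; * (A3) $\Phi\vdash_\varepsilon L_r(\phi\land\psi)\land L_s(\phi\land\lnot\psi)\to L_{r+s-\varepsilon}\phi$; * (A4) $\Phi\vdash_\varepsilon \lnot L_r(\phi\land\psi)\land\lnot L_s(\phi\land\lnot\psi)\to\lnot L_{r+s-\varepsilon}\phi$; and which is closed under the rules * (R1) if $\emptyset\vdash_\varepsilon\phi\to\psi$, then $\Phi\vdash_\varepsilon L_r\phi\to L_r\psi$; * (R2) if $\Phi\vdash_\varepsilon L_r\phi$ for all rationals $r$ with $0\le r<s$, then $\Phi\vdash_\varepsilon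 L_s\phi$; * (R3) if $\Phi\vdash_\varepsilon L_r\phi$ for all rationals $r>s$, then $\Phi\vdash_\varepsilon\bot$. A formula $\phi$ is $\varepsilon$-consistent if $\emptyset\vdash_\varepsilon\phi\to\bot$ does not hold. **Theorem (Finite model property).** For every rational $\varepsilon\ge0$ and every $\varepsilon$-consistent formula $\phi$ there exists a finite CMP $(\mathcal M,m)$ such that $m\models_\varepsilon\phi$. -/

import Mathlib

namespace CML

/-! ## Continuous Markov processes -/

/-- An analytic space: a topological space homeomorphic to the image of a continuous map
between Polish spaces. -/
def IsAnalyticSpace (M : Type*) [TopologicalSpace M] : Prop :=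
  ∃ (P Q : Type) (_ : TopologicalSpace P) (_ : TopologicalSpace Q)
    (_ : PolishSpace P) (_ : PolishSpace Q) (f : P → Q),
    Continuous f ∧ Nonempty (M ≃ₜ Set.range f)

/-- A continuous Markov kernel: an analytic space with its Borel `σ`-algebra and a measurable
map `θ` from the space to the space of finite measures on it. (The `σ`-algebra on measures is
generated by the evaluations at measurable sets, as in `ProbabilityTheory.Kernel`; the total
mass of `θ m` is finite for every `m`, but need not be bounded uniformly in `m`.) -/
structure CMK.{u} where
  /-- the support-set -/
  carrier : Type u
  [topology : TopologicalSpace carrier]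
  [sigma : MeasurableSpace carrier]
  [borel : BorelSpace carrier]
  analytic : IsAnalyticSpace carrier
  /-- the transition function -/
  θ : ProbabilityTheory.Kernel carrier carrier
  finite_rate : ∀ m, MeasureTheory.IsFiniteMeasure (θ m)

attribute [instance] CMK.topology CMK.sigma CMK.borel

/-! ## Syntax -/

/-- Formulae `φ ::= ⊤ | ¬φ | φ ∧ φ | L_r φ`, with `r` a nonnegative rational. -/
inductive Formula : Type
  | top : Formula
  | neg : Formula → Formula
  | and : Formula → Formula → Formula
  | L : ℚ≥0 → Formula → Formula

namespace Formula

/-- `⊥ = ¬⊤`. -/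
def bot : Formula := neg top

/-- `φ → ψ`, that is `¬(φ ∧ ¬ψ)`. -/
def imp (φ ψ : Formula) : Formula := neg (and φ (neg ψ))

/-- Classical propositional truth value, the formulae `L_r φ` being treated as atoms. -/
def eval (v : ℚ≥0 → Formula → Prop) : Formula → Prop
  | top => True
  | neg φ => ¬ eval v φ
  | and φ ψ => eval v φ ∧ eval v ψ
  | L r φ => v r φ

/-- Instances of propositional tautologies. -/
def IsTautology (φ : Formula) : Prop := ∀ v, eval v φ

end Formula

/-! ## Semantics -/

/-- `M.Sat ε φ m` is the `ε`-satisfiability relation `m ⊨_ε φ`; in particular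
`m ⊨_ε L_r φ` iff `θ(m)({n | n ⊨_ε φ}) + ε ≥ r`. -/
def CMK.Sat (M : CMK) (ε : ℚ≥0) : Formula → M.carrier → Prop
  | .top, _ => True
  | .neg φ, m => ¬ M.Sat ε φ m
  | .and φ ψ, m => M.Sat ε φ m ∧ M.Sat ε ψ m
  | .L r φ, m => (r : ℝ) ≤ (M.θ m).real {n | M.Sat ε φ n} + (ε : ℝ)

/-- The sets of states defined by formulae are measurable, so that the clause for `L_r φ` in
`CMK.Sat` makes sense. -/
theorem CMK.measurableSet_sat (M : CMK) (ε : ℚ≥0) (φ : Formula) :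
    MeasurableSet {m | M.Sat ε φ m} := by
  induction φ with
  | top => simp [CMK.Sat]
  | neg φ ih => exact ih.compl
  | and φ ψ ih₁ ih₂ => exact ih₁.inter ih₂
  | L r φ ih =>
    simp only [CMK.Sat]
    exact measurableSet_le measurable_const
      (((M.θ.measurable_coe ih).ennreal_toReal).add measurable_const)

/-! ## Provability -/

open Formula in
/-- `Derives ε Φ φ` is the relation `Φ ⊢_ε φ`: classical propositional logic (tautologies, modus
ponens, discharge of hypotheses) together with the axioms (A1)-(A4) and the rules (R1)-(R3) of
`ε`-provability. All the indices of the operators `L` are nonnegative rationals; in (A3) and (A4)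
the index `t` is `r + s - ε`. (R1) applies to theorems only. (R2) and (R3) are the infinitary
rules `{L_r φ | r < s} ⊢_ε L_s φ` and `{L_r φ | r > s} ⊢_ε ⊥`, closed under cut. -/
inductive Derives (ε : ℚ≥0) : Set Formula → Formula → Prop
  | hyp {Φ : Set Formula} {φ : Formula} : φ ∈ Φ → Derives ε Φ φ
  | taut {Φ : Set Formula} {φ : Formula} : IsTautology φ → Derives ε Φ φ
  | mp {Φ : Set Formula} {φ ψ : Formula} :
      Derives ε Φ (imp φ ψ) → Derives ε Φ φ → Derives ε Φ ψ
  | ded {Φ : Set Formula} {φ ψ : Formula} :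
      Derives ε (insert φ Φ) ψ → Derives ε Φ (imp φ ψ)
  | A1 {Φ : Set Formula} (φ : Formula) : Derives ε Φ (L ε φ)
  | A2 {Φ : Set Formula} (r s : ℚ≥0) (φ : Formula) :
      Derives ε Φ (imp (L (r + s) φ) (L r φ))
  | A3 {Φ : Set Formula} (r s t : ℚ≥0) (φ ψ : Formula) : t + ε = r + s →
      Derives ε Φ (imp (and (L r (and φ ψ)) (L s (and φ (neg ψ)))) (L t φ))
  | A4 {Φ : Set Formula} (r s t : ℚ≥0) (φ ψ : Formula) : t + ε = r + s →
      Derives ε Φ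
        (imp (and (neg (L r (and φ ψ))) (neg (L s (and φ (neg ψ))))) (neg (L t φ)))
  | R1 {Φ : Set Formula} (r : ℚ≥0) {φ ψ : Formula} :
      Derives ε ∅ (imp φ ψ) → Derives ε Φ (imp (L r φ) (L r ψ))
  | R2 {Φ : Set Formula} (s : ℚ≥0) (φ : Formula) :
      (∀ r : ℚ≥0, r < s → Derives ε Φ (L r φ)) → Derives ε Φ (L s φ)
  | R3 {Φ : Set Formula} (s : ℚ≥0) (φ : Formula) :
      (∀ r : ℚ≥0, s < r → Derives ε Φ (L r φ)) → Derives ε Φ bot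

/-- `⊢_ε φ`. -/
def Provable (ε : ℚ≥0) (φ : Formula) : Prop := Derives ε ∅ φ

/-- A formula `φ` is `ε`-consistent if `φ → ⊥` is not `ε`-provable. -/
def Consistent (ε : ℚ≥0) (φ : Formula) : Prop := ¬ Provable ε (Formula.imp φ Formula.bot)

end CML

/-! Given a saturated set `Γ`, the axioms (A1)-(A4) say that
`rate Γ φ = sup {r | L r φ ∈ Γ} - ε` is nonnegative and finitely additive in `φ`, while (R2) and
(R3) make the supremum attained and finite; thus `L r φ ∈ Γ` iff `r ≤ rate Γ φ + ε`. Because the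
rules (R2) and (R3) are infinitary, a consistent formula is extended to a saturated set by the
Rasiowa–Sikorski lemma instead of Zorn's lemma: there are only countably many premises to meet.

On finitely many formulae a finitely additive rate is represented by a genuine measure on the
saturated sets, namely a combination of Dirac masses at saturated sets extending the consistent
Boolean combinations of these formulae. Pushing it forward to the finite quotient that
identifies saturated sets with the same subformulae of `φ` (filtration) gives the model. -/

namespace CML

open MeasureTheory Set
open Formula (L)

section Derivability

variable {ε : ℚ≥0} {Φ Ψ : Set Formula} {φ ψ χ γ : Formula}

@[simp]
theorem Formula.eval_imp (v : ℚ≥0 → Formula → Prop) (φ ψ : Formula) :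
    (φ.imp ψ).eval v ↔ (φ.eval v → ψ.eval v) := by
  simp only [imp, eval, not_and, not_not]

@[simp]
theorem Formula.not_eval_bot (v : ℚ≥0 → Formula → Prop) : ¬ Formula.bot.eval v := by
  simp only [bot, eval, not_true_eq_false, not_false_eq_true]

namespace Derives

theorem mono (h : Derives ε Φ φ) (hΦ : Φ ⊆ Ψ) : Derives ε Ψ φ := by
  induction h generalizing Ψ with
  | hyp h => exact .hyp (hΦ h)
  | taut h => exact .taut h
  | mp _ _ ih₁ ih₂ => exact .mp (ih₁ hΦ) (ih₂ hΦ)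
  | ded _ ih => exact .ded (ih (insert_subset_insert hΦ))
  | A1 φ => exact .A1 φ
  | A2 r s φ => exact .A2 r s φ
  | A3 r s t φ ψ h => exact .A3 r s t φ ψ h
  | A4 r s t φ ψ h => exact .A4 r s t φ ψ h
  | R1 r h => exact .R1 r h
  | R2 s φ _ ih => exact .R2 s φ fun r hr => ih r hr hΦ
  | R3 s φ _ ih => exact .R3 s φ fun r hr => ih r hr hΦ

theorem of_eval_imp (hv : ∀ v, φ.eval v → ψ.eval v) (h : Derives ε Φ φ) : Derives ε Φ ψ :=
  .mp (.taut fun v => (Formula.eval_imp v φ ψ).2 (hv v)) h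

theorem of_eval_imp₂ (hv : ∀ v, φ.eval v → ψ.eval v → χ.eval v) (h₁ : Derives ε Φ φ)
    (h₂ : Derives ε Φ ψ) : Derives ε Φ χ :=
  .mp (of_eval_imp (fun v => by simpa only [Formula.eval_imp] using hv v) h₁) h₂

end Derives

/-- The Lindenbaum–Tarski preorder on formulae: `φ` entails `ψ` if `φ → ψ` is `ε`-provable. -/
def Entails (ε : ℚ≥0) (φ ψ : Formula) : Prop := Provable ε (φ.imp ψ)

theorem entails_iff_derives : Entails ε φ ψ ↔ Derives ε {φ} ψ :=
  ⟨fun h => .mp (h.mono (empty_subset _)) (.hyp rfl),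
    fun h => .ded (by rwa [insert_empty_eq])⟩

theorem not_consistent_iff : ¬ Consistent ε φ ↔ Entails ε φ .bot :=
  not_not

namespace Entails

theorem of_eval (hv : ∀ v, φ.eval v → ψ.eval v) : Entails ε φ ψ :=
  .taut fun v => (Formula.eval_imp v φ ψ).2 (hv v)

theorem refl (φ : Formula) : Entails ε φ φ :=
  of_eval fun _ => id

theorem trans (h₁ : Entails ε φ ψ) (h₂ : Entails ε ψ χ) : Entails ε φ χ :=
  Derives.of_eval_imp₂ (fun v => by simp only [Formula.eval_imp]; tauto) h₁ h₂

theorem and (h₁ : Entails ε γ φ) (h₂ : Entails ε γ ψ) : Entails ε γ (φ.and ψ) :=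
  Derives.of_eval_imp₂ (fun v => by simp only [Formula.eval_imp, Formula.eval]; tauto) h₁ h₂

theorem and_left (φ ψ : Formula) : Entails ε (φ.and ψ) φ :=
  of_eval fun _ h => h.1

theorem and_right (φ ψ : Formula) : Entails ε (φ.and ψ) ψ :=
  of_eval fun _ h => h.2

end Entails

theorem not_consistent_and_neg_iff : ¬ Consistent ε (γ.and φ.neg) ↔ Entails ε γ φ := by
  rw [not_consistent_iff]
  constructor <;> refine Derives.of_eval_imp fun v => ?_ <;>
    simp only [Formula.eval_imp, Formula.eval, Formula.not_eval_bot] <;> tauto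

namespace Consistent

theorem mono (h : Consistent ε φ) (hφψ : Entails ε φ ψ) : Consistent ε ψ :=
  fun hψ => h (hφψ.trans hψ)

theorem and_or_and_neg (h : Consistent ε γ) (φ : Formula) :
    Consistent ε (γ.and φ) ∨ Consistent ε (γ.and φ.neg) := by
  rw [or_iff_not_imp_right, not_consistent_and_neg_iff]
  exact fun hφ => h.mono ((Entails.refl γ).and hφ)

theorem and_L_or_exists_lt (h : Consistent ε γ) (s : ℚ≥0) (φ : Formula) :
    Consistent ε (γ.and (L s φ)) ∨ ∃ r < s, Consistent ε (γ.and (L r φ).neg) := by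
  by_contra! hc
  have hr : ∀ r < s, Entails ε γ (L r φ) := fun r hrs =>
    not_consistent_and_neg_iff.1 (hc.2 r hrs)
  have hs : Entails ε γ (L s φ) :=
    entails_iff_derives.2 (.R2 s φ fun r hrs => entails_iff_derives.1 (hr r hrs))
  exact hc.1 (h.mono ((Entails.refl γ).and hs))

theorem exists_and_neg_L (h : Consistent ε γ) (φ : Formula) :
    ∃ r, Consistent ε (γ.and (L r φ).neg) := by
  by_contra! hc
  exact h (entails_iff_derives.2 (.R3 0 φ fun r _ =>
    entails_iff_derives.1 (not_consistent_and_neg_iff.1 (hc r))))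

end Consistent

end Derivability

section SaturatedSets

/-- A theory: a proper, possibly empty, filter of formulae for the preorder `CML.Entails`. -/
structure IsTheory (ε : ℚ≥0) (Γ : Set Formula) : Prop where
  mem_of_entails : ∀ {φ ψ}, Entails ε φ ψ → φ ∈ Γ → ψ ∈ Γ
  and_mem : ∀ {φ ψ}, φ ∈ Γ → ψ ∈ Γ → φ.and ψ ∈ Γ
  bot_notMem : Formula.bot ∉ Γ

/-- A complete theory that is closed under the infinitary rules (R2) and (R3). -/
structure IsSaturated (ε : ℚ≥0) (Γ : Set Formula) : Prop extends IsTheory ε Γ where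
  mem_or_neg_mem : ∀ φ, φ ∈ Γ ∨ φ.neg ∈ Γ
  L_mem_of_forall_lt : ∀ {s φ}, (∀ r < s, L r φ ∈ Γ) → L s φ ∈ Γ
  exists_L_notMem : ∀ φ, ∃ r, L r φ ∉ Γ

variable {ε : ℚ≥0} {Γ : Set Formula} {φ ψ : Formula}

theorem IsTheory.neg_notMem (hΓ : IsTheory ε Γ) (hφ : φ ∈ Γ) : φ.neg ∉ Γ := fun hn =>
  hΓ.bot_notMem (hΓ.mem_of_entails (.of_eval fun _ h => (h.2 h.1).elim) (hΓ.and_mem hφ hn))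

/-- The consistent formulae, as a notion of forcing: larger formulae are stronger. -/
def ConsistentFormula (ε : ℚ≥0) : Type := {γ : Formula // Consistent ε γ}

instance (ε : ℚ≥0) : Preorder (ConsistentFormula ε) where
  le γ δ := Entails ε δ.1 γ.1
  le_refl γ := .refl γ.1
  le_trans _ _ _ h₁ h₂ := h₂.trans h₁

theorem isTheory_of_ideal (I : Order.Ideal (ConsistentFormula ε)) :
    IsTheory ε {φ | ∃ γ ∈ I, Entails ε γ.1 φ} where
  mem_of_entails := fun h ⟨γ, hγ, hφ⟩ => ⟨γ, hγ, hφ.trans h⟩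
  and_mem := fun ⟨γ, hγ, hφ⟩ ⟨δ, hδ, hψ⟩ =>
    let ⟨β, hβ, hγβ, hδβ⟩ := I.directed γ hγ δ hδ
    ⟨β, hβ, (Entails.trans hγβ hφ).and (Entails.trans hδβ hψ)⟩
  bot_notMem := fun ⟨γ, _, h⟩ => γ.2 h

theorem Consistent.exists_isTheory_inter_nonempty {𝒜 : Set (Set Formula)} (h𝒜 : 𝒜.Countable)
    (hdense : ∀ A ∈ 𝒜, ∀ γ, Consistent ε γ → ∃ α ∈ A, Consistent ε (γ.and α))
    (hφ : Consistent ε φ) :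
    ∃ Γ, IsTheory ε Γ ∧ φ ∈ Γ ∧ ∀ A ∈ 𝒜, (A ∩ Γ).Nonempty := by
  let : Encodable 𝒜 := h𝒜.toEncodable
  let D (A : 𝒜) : Order.Cofinal (ConsistentFormula ε) :=
    { carrier := {γ | ∃ α ∈ A.1, Entails ε γ.1 α}
      isCofinal := fun γ =>
        let ⟨α, hα, hγα⟩ := hdense A A.2 γ.1 γ.2
        ⟨⟨γ.1.and α, hγα⟩, ⟨α, hα, .and_right γ.1 α⟩, .and_left γ.1 α⟩ }
  let p : ConsistentFormula ε := ⟨φ, hφ⟩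
  refine ⟨_, isTheory_of_ideal (Order.idealOfCofinals p D),
    ⟨p, Order.mem_idealOfCofinals p D, .refl φ⟩, fun A hA => ?_⟩
  obtain ⟨γ, ⟨α, hα, hγα⟩, hγ⟩ := Order.cofinal_meets_idealOfCofinals p D ⟨A, hA⟩
  exact ⟨α, hα, γ, hγ, hγα⟩

/-- An injective numbering of the formulae, each being encoded by its outermost constructor and
the numbers of its immediate subformulae. -/
def Formula.code : Formula → ℕ
  | top => Encodable.encode (none : Option (ℕ ⊕ ℕ × ℕ ⊕ ℚ≥0 × ℕ))
  | neg φ => Encodable.encode (some (.inl φ.code) : Option (ℕ ⊕ ℕ × ℕ ⊕ ℚ≥0 × ℕ))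
  | and φ ψ =>
    Encodable.encode (some (.inr (.inl (φ.code, ψ.code))) : Option (ℕ ⊕ ℕ × ℕ ⊕ ℚ≥0 × ℕ))
  | L r φ => Encodable.encode (some (.inr (.inr (r, φ.code))) : Option (ℕ ⊕ ℕ × ℕ ⊕ ℚ≥0 × ℕ))

theorem Formula.code_injective : Function.Injective Formula.code := by
  intro φ ψ h
  induction φ generalizing ψ <;> cases ψ <;>
    simp only [code, Encodable.encode_inj, Option.some.injEq, reduceCtorEq, Sum.inl.injEq,
      Sum.inr.injEq, Prod.mk.injEq] at h <;> grind

instance : Countable Formula := Formula.code_injective.countable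

theorem Consistent.exists_isSaturated (hφ : Consistent ε φ) :
    ∃ Γ, IsSaturated ε Γ ∧ φ ∈ Γ := by
  let deciding (φ : Formula) : Set Formula := {φ, φ.neg}
  let attaining (p : ℚ≥0 × Formula) : Set Formula :=
    insert (L p.1 p.2) {α | ∃ r < p.1, α = (L r p.2).neg}
  let bounding (φ : Formula) : Set Formula := {α | ∃ r, α = (L r φ).neg}
  obtain ⟨Γ, hΓ, hφΓ, hmeet⟩ := hφ.exists_isTheory_inter_nonempty
    (𝒜 := range deciding ∪ range attaining ∪ range bounding)
    (((countable_range _).union (countable_range _)).union (countable_range _)) (by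
      rintro _ ((⟨φ, rfl⟩ | ⟨⟨s, φ⟩, rfl⟩) | ⟨φ, rfl⟩) γ hγ
      · simpa [deciding] using hγ.and_or_and_neg φ
      · simpa [attaining] using hγ.and_L_or_exists_lt s φ
      · simpa [bounding] using hγ.exists_and_neg_L φ)
  refine ⟨Γ, ⟨hΓ, fun φ => ?_, fun {s φ} hs => ?_, fun φ => ?_⟩, hφΓ⟩
  · obtain ⟨_, rfl | rfl, hα⟩ := hmeet _ (.inl (.inl ⟨φ, rfl⟩))
    exacts [.inl hα, .inr hα]
  · obtain ⟨_, rfl | ⟨r, hr, rfl⟩, hα⟩ := hmeet _ (.inl (.inr ⟨(s, φ), rfl⟩))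
    exacts [hα, (hΓ.neg_notMem (hs r hr) hα).elim]
  · obtain ⟨_, ⟨r, rfl⟩, hα⟩ := hmeet _ (.inr ⟨φ, rfl⟩)
    exact ⟨r, fun hr => hΓ.neg_notMem hr hα⟩

namespace IsSaturated

theorem neg_mem_iff (hΓ : IsSaturated ε Γ) : φ.neg ∈ Γ ↔ φ ∉ Γ :=
  ⟨fun hn hφ => hΓ.neg_notMem hφ hn, (hΓ.mem_or_neg_mem φ).resolve_left⟩

theorem and_mem_iff (hΓ : IsSaturated ε Γ) : φ.and ψ ∈ Γ ↔ φ ∈ Γ ∧ ψ ∈ Γ :=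
  ⟨fun h => ⟨hΓ.mem_of_entails (.and_left φ ψ) h, hΓ.mem_of_entails (.and_right φ ψ) h⟩,
    fun h => hΓ.and_mem h.1 h.2⟩

theorem mem_of_provable (hΓ : IsSaturated ε Γ) (h : Provable ε φ) : φ ∈ Γ := by
  by_contra hφ
  exact hΓ.bot_notMem (hΓ.mem_of_entails
    (Derives.of_eval_imp (fun v => by simp only [Formula.eval_imp, Formula.eval]; tauto) h)
    (hΓ.neg_mem_iff.2 hφ))

theorem L_mem_of_le (hΓ : IsSaturated ε Γ) {r s : ℚ≥0} (hrs : r ≤ s) (h : L s φ ∈ Γ) :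
    L r φ ∈ Γ := by
  obtain ⟨t, rfl⟩ := exists_add_of_le hrs
  exact hΓ.mem_of_entails (.A2 r t φ) h

end IsSaturated

end SaturatedSets

section Rates

/-- The rate at which a process satisfying the formulae in `Γ` moves to states satisfying `φ`;
the shift by `ε` matches the one in the clause of `CML.CMK.Sat` for `L r φ`. The supremum is junk
unless the set is nonempty and bounded, as it is for a saturated `Γ`. -/
noncomputable def rate (ε : ℚ≥0) (Γ : Set Formula) (φ : Formula) : ℝ :=
  sSup ((↑) '' {r : ℚ≥0 | L r φ ∈ Γ}) - ε

variable {ε : ℚ≥0} {Γ : Set Formula} {φ ψ : Formula} {x : ℝ}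

namespace IsSaturated

theorem bddAbove_L_mem (hΓ : IsSaturated ε Γ) (φ : Formula) :
    BddAbove ((↑) '' {r : ℚ≥0 | L r φ ∈ Γ} : Set ℝ) := by
  obtain ⟨b, hb⟩ := hΓ.exists_L_notMem φ
  refine ⟨b, forall_mem_image.2 fun r hr => ?_⟩
  have hrb : r ≤ b := le_of_not_ge fun hbr => hb (hΓ.L_mem_of_le hbr hr)
  exact_mod_cast hrb

theorem rate_le_of_forall_L_mem (hΓ : IsSaturated ε Γ)
    (h : ∀ r : ℚ≥0, L r φ ∈ Γ → (r : ℝ) ≤ x + ε) : rate ε Γ φ ≤ x :=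
  sub_le_iff_le_add.2 (csSup_le ⟨ε, ε, hΓ.mem_of_provable (.A1 φ), rfl⟩ (forall_mem_image.2 h))

theorem L_mem_iff_le_rate (hΓ : IsSaturated ε Γ) {r : ℚ≥0} :
    L r φ ∈ Γ ↔ (r : ℝ) ≤ rate ε Γ φ + ε := by
  constructor
  · intro h
    exact sub_le_iff_le_add.1 (sub_le_sub_right (le_csSup (hΓ.bddAbove_L_mem φ) ⟨r, h, rfl⟩) _)
  · refine fun h => hΓ.L_mem_of_forall_lt fun s hs => ?_
    by_contra hsφ
    have hle : rate ε Γ φ ≤ s - ε := hΓ.rate_le_of_forall_L_mem fun t ht => by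
      have hts : t ≤ s := le_of_not_ge fun hst => hsφ (hΓ.L_mem_of_le hst ht)
      rw [sub_add_cancel]
      exact_mod_cast hts
    have hs : (s : ℝ) < r := by exact_mod_cast hs
    linarith

theorem rate_nonneg (hΓ : IsSaturated ε Γ) (φ : Formula) : 0 ≤ rate ε Γ φ := by
  simpa using hΓ.L_mem_iff_le_rate.1 (hΓ.mem_of_provable (.A1 φ))

theorem le_rate_of_forall_L_notMem (hΓ : IsSaturated ε Γ)
    (h : ∀ r : ℚ≥0, L r φ ∉ Γ → x + ε ≤ r) : x ≤ rate ε Γ φ := by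
  by_contra! hlt
  obtain ⟨q, hq, hqx⟩ := exists_rat_btwn (add_lt_add_left hlt (ε : ℝ))
  have hq₀ : 0 ≤ q := by
    have : (0 : ℝ) ≤ q := (add_nonneg (hΓ.rate_nonneg φ) (by positivity)).trans hq.le
    exact_mod_cast this
  lift q to ℚ≥0 using hq₀
  exact (h q (hΓ.L_mem_iff_le_rate.not.2 (not_le.2 hq))).not_gt hqx

theorem rate_mono (hΓ : IsSaturated ε Γ) (h : Entails ε φ ψ) : rate ε Γ φ ≤ rate ε Γ ψ :=
  hΓ.rate_le_of_forall_L_mem fun r hr =>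
    hΓ.L_mem_iff_le_rate.1 (hΓ.mem_of_entails (.R1 r h) hr)

theorem rate_congr (hΓ : IsSaturated ε Γ) (h : ∀ v, φ.eval v ↔ ψ.eval v) :
    rate ε Γ φ = rate ε Γ ψ :=
  le_antisymm (hΓ.rate_mono (.of_eval fun v => (h v).1))
    (hΓ.rate_mono (.of_eval fun v => (h v).2))

theorem rate_and_add_rate_and_neg_le (hΓ : IsSaturated ε Γ) (φ ψ : Formula) :
    rate ε Γ (φ.and ψ) + rate ε Γ (φ.and ψ.neg) ≤ rate ε Γ φ := by
  have key : ∀ r s : ℚ≥0, L r (φ.and ψ) ∈ Γ → L s (φ.and ψ.neg) ∈ Γ →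
      (r + s : ℝ) ≤ rate ε Γ φ + ε + ε := by
    intro r s hr hs
    rcases le_total ε (r + s) with hε | hε
    · obtain ⟨t, ht⟩ := exists_add_of_le hε
      have := hΓ.L_mem_iff_le_rate.1
        (hΓ.mem_of_entails (.A3 r s t φ ψ (by rw [ht, add_comm])) (hΓ.and_mem hr hs))
      have ht : (r + s : ℝ) = ε + t := by exact_mod_cast ht
      linarith
    · have hε : (r + s : ℝ) ≤ ε := by exact_mod_cast hε
      linarith [hΓ.rate_nonneg φ, (by positivity : (0 : ℝ) ≤ ε)]
  rw [← le_sub_iff_add_le]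
  refine hΓ.rate_le_of_forall_L_mem fun r hr => ?_
  suffices rate ε Γ (φ.and ψ.neg) ≤ rate ε Γ φ + ε - r by linarith
  refine hΓ.rate_le_of_forall_L_mem fun s hs => ?_
  linarith [key r s hr hs]

theorem rate_le_rate_and_add_rate_and_neg (hΓ : IsSaturated ε Γ) (φ ψ : Formula) :
    rate ε Γ φ ≤ rate ε Γ (φ.and ψ) + rate ε Γ (φ.and ψ.neg) := by
  have key : ∀ r s : ℚ≥0, L r (φ.and ψ) ∉ Γ → L s (φ.and ψ.neg) ∉ Γ →
      rate ε Γ φ + ε + ε ≤ r + s := by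
    intro r s hr hs
    have hεr : ε ≤ r := le_of_not_ge fun h => hr (hΓ.L_mem_of_le h (hΓ.mem_of_provable (.A1 _)))
    obtain ⟨t, ht⟩ := exists_add_of_le (hεr.trans (le_add_of_nonneg_right zero_le))
    have hneg : (L t φ).neg ∈ Γ := hΓ.mem_of_entails (.A4 r s t φ ψ (by rw [ht, add_comm]))
      (hΓ.and_mem (hΓ.neg_mem_iff.2 hr) (hΓ.neg_mem_iff.2 hs))
    rw [hΓ.neg_mem_iff, hΓ.L_mem_iff_le_rate] at hneg
    have ht : (r + s : ℝ) = ε + t := by exact_mod_cast ht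
    linarith
  rw [← sub_le_iff_le_add]
  refine hΓ.le_rate_of_forall_L_notMem fun r hr => ?_
  suffices rate ε Γ φ + ε - r ≤ rate ε Γ (φ.and ψ.neg) by linarith
  refine hΓ.le_rate_of_forall_L_notMem fun s hs => ?_
  linarith [key r s hr hs]

theorem rate_eq_rate_and_add_rate_and_neg (hΓ : IsSaturated ε Γ) (φ ψ : Formula) :
    rate ε Γ φ = rate ε Γ (φ.and ψ) + rate ε Γ (φ.and ψ.neg) :=
  le_antisymm (hΓ.rate_le_rate_and_add_rate_and_neg φ ψ) (hΓ.rate_and_add_rate_and_neg_le φ ψ)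

theorem rate_eq_zero_of_not_consistent (hΓ : IsSaturated ε Γ) (h : ¬ Consistent ε φ) :
    rate ε Γ φ = 0 := by
  have hle : ∀ ψ, rate ε Γ φ ≤ rate ε Γ (φ.and ψ) := fun ψ =>
    hΓ.rate_mono ((not_consistent_iff.1 h).trans (.of_eval fun v hv =>
      (Formula.not_eval_bot v hv).elim))
  linarith [hle .top, hle (.neg .top), hΓ.rate_and_add_rate_and_neg_le φ .top,
    hΓ.rate_nonneg φ]

end IsSaturated

end Rates

section Representation

/-- The space of saturated sets, with the discrete `σ`-algebra (all measures on it that occur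
below are finite sums of point masses). -/
def SaturatedSet (ε : ℚ≥0) : Type := {Γ : Set Formula // IsSaturated ε Γ}

instance (ε : ℚ≥0) : MeasurableSpace (SaturatedSet ε) := ⊤

instance (ε : ℚ≥0) : DiscreteMeasurableSpace (SaturatedSet ε) := ⟨fun _ => trivial⟩

/-- `μ` represents the rates of `Γ` below `θ` on `S`: it lives on the saturated sets containing
`θ` and gives the set of those containing `ψ ∈ S` the mass `rate ε Γ (θ ∧ ψ)`. -/
structure RepresentsRate (Γ : Set Formula) (S : Set Formula) (θ : Formula) {ε : ℚ≥0}
    (μ : Measure (SaturatedSet ε)) : Prop where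
  isFiniteMeasure : IsFiniteMeasure μ
  ae_mem : ∀ᵐ Δ ∂μ, θ ∈ Δ.1
  real_univ : μ.real univ = rate ε Γ θ
  real_mem : ∀ ψ ∈ S, μ.real {Δ | ψ ∈ Δ.1} = rate ε Γ (θ.and ψ)

variable {ε : ℚ≥0} {Γ S : Set Formula} {θ χ : Formula}

theorem IsSaturated.exists_representsRate_empty (hΓ : IsSaturated ε Γ) (θ : Formula) :
    ∃ μ : Measure (SaturatedSet ε), RepresentsRate Γ ∅ θ μ := by
  by_cases hθ : Consistent ε θ
  · obtain ⟨Δ, hΔ, hθΔ⟩ := hθ.exists_isSaturated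
    let Δ' : SaturatedSet ε := ⟨Δ, hΔ⟩
    refine ⟨ENNReal.ofReal (rate ε Γ θ) • Measure.dirac Δ',
      ⟨Measure.smul_finite _ ENNReal.ofReal_ne_top, Measure.ae_smul_measure ?_ _, ?_, by simp⟩⟩
    · exact (ae_dirac_iff .of_discrete).2 hθΔ
    · rw [measureReal_ennreal_smul_apply, probReal_univ, mul_one,
        ENNReal.toReal_ofReal (hΓ.rate_nonneg θ)]
  · exact ⟨0, inferInstance, by simp, by simp [hΓ.rate_eq_zero_of_not_consistent hθ], by simp⟩

theorem RepresentsRate.add {μ ν : Measure (SaturatedSet ε)} (hΓ : IsSaturated ε Γ)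
    (hμ : RepresentsRate Γ S (θ.and χ) μ) (hν : RepresentsRate Γ S (θ.and χ.neg) ν) :
    RepresentsRate Γ (insert χ S) θ (μ + ν) := by
  have := hμ.isFiniteMeasure
  have := hν.isFiniteMeasure
  refine ⟨inferInstance, ae_add_measure_iff.2 ⟨?_, ?_⟩, ?_, forall_mem_insert.2 ⟨?_, ?_⟩⟩
  · filter_upwards [hμ.ae_mem] with Δ hΔ using (Δ.2.and_mem_iff.1 hΔ).1
  · filter_upwards [hν.ae_mem] with Δ hΔ using (Δ.2.and_mem_iff.1 hΔ).1
  · rw [measureReal_add_apply, hμ.real_univ, hν.real_univ,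
      ← hΓ.rate_eq_rate_and_add_rate_and_neg]
  · have hμχ : {Δ : SaturatedSet ε | χ ∈ Δ.1} =ᵐ[μ] univ := by
      filter_upwards [hμ.ae_mem] with Δ hΔ using eq_true (Δ.2.and_mem_iff.1 hΔ).2
    have hνχ : {Δ : SaturatedSet ε | χ ∈ Δ.1} =ᵐ[ν] (∅ : Set (SaturatedSet ε)) := by
      filter_upwards [hν.ae_mem] with Δ hΔ using
        eq_false (Δ.2.neg_mem_iff.1 (Δ.2.and_mem_iff.1 hΔ).2)
    rw [measureReal_add_apply, measureReal_congr hμχ, measureReal_congr hνχ, hμ.real_univ,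
      measureReal_empty, add_zero]
  · intro ψ hψ
    rw [measureReal_add_apply, hμ.real_mem ψ hψ, hν.real_mem ψ hψ,
      hΓ.rate_eq_rate_and_add_rate_and_neg (θ.and ψ) χ]
    congr 1 <;> exact hΓ.rate_congr fun v => by simp only [Formula.eval]; tauto

theorem IsSaturated.exists_representsRate (hΓ : IsSaturated ε Γ) (hS : S.Finite) (θ : Formula) :
    ∃ μ : Measure (SaturatedSet ε), RepresentsRate Γ S θ μ := by
  induction S, hS using Set.Finite.induction_on generalizing θ with
  | empty => exact hΓ.exists_representsRate_empty θ
  | @insert χ S _ _ ih =>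
    obtain ⟨μ, hμ⟩ := ih (θ.and χ)
    obtain ⟨ν, hν⟩ := ih (θ.and χ.neg)
    exact ⟨μ + ν, hμ.add hΓ hν⟩

theorem IsSaturated.exists_measure_real_eq_rate (hΓ : IsSaturated ε Γ) (hS : S.Finite) :
    ∃ μ : Measure (SaturatedSet ε), IsFiniteMeasure μ ∧
      ∀ ψ ∈ S, μ.real {Δ | ψ ∈ Δ.1} = rate ε Γ ψ := by
  obtain ⟨μ, hμ⟩ := hΓ.exists_representsRate hS .top
  refine ⟨μ, hμ.isFiniteMeasure, fun ψ hψ => (hμ.real_mem ψ hψ).trans ?_⟩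
  exact hΓ.rate_congr fun v => by simp only [Formula.eval, true_and]

end Representation

section Filtration

theorem isAnalyticSpace_of_polishSpace (M : Type) [TopologicalSpace M] [PolishSpace M] :
    IsAnalyticSpace M :=
  ⟨M, M, inferInstance, inferInstance, inferInstance, inferInstance, id, continuous_id,
    ⟨(Homeomorph.Set.univ M).symm.trans (Homeomorph.setCongr range_id.symm)⟩⟩

/-- Saturated sets that agree on `S`. -/
def agreeSetoid (ε : ℚ≥0) (S : Set Formula) : Setoid (SaturatedSet ε) :=
  Setoid.ker fun Γ => Γ.1 ∩ S

/-- The states of the filtration through `S`: saturated sets up to agreement on `S`. -/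
def FiltrationState (ε : ℚ≥0) (S : Set Formula) : Type := Quotient (agreeSetoid ε S)

namespace FiltrationState

variable {ε : ℚ≥0} {S : Set Formula} {ψ : Formula}

/-- The state of a saturated set. -/
def mk (S : Set Formula) (Γ : SaturatedSet ε) : FiltrationState ε S :=
  Quotient.mk _ Γ

/-- A saturated set representing a state. -/
noncomputable def out (w : FiltrationState ε S) : SaturatedSet ε :=
  Quotient.out w

theorem mem_out_mk_iff (Γ : SaturatedSet ε) (hψ : ψ ∈ S) : ψ ∈ (mk S Γ).out.1 ↔ ψ ∈ Γ.1 := by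
  have h : (mk S Γ).out.1 ∩ S = Γ.1 ∩ S := Quotient.mk_out (s := agreeSetoid ε S) Γ
  simpa only [mem_inter_iff, hψ, and_true] using Set.ext_iff.1 h ψ

theorem finite (ε : ℚ≥0) (hS : S.Finite) : Finite (FiltrationState ε S) := by
  have : Finite (range fun Γ : SaturatedSet ε => Γ.1 ∩ S) :=
    hS.finite_subsets.subset (range_subset_iff.2 fun _ => inter_subset_right)
  exact .of_equiv _ (Setoid.quotientKerEquivRange _).symm

instance : TopologicalSpace (FiltrationState ε S) := ⊥

instance : DiscreteTopology (FiltrationState ε S) := ⟨rfl⟩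

instance : MeasurableSpace (FiltrationState ε S) := ⊤

instance : DiscreteMeasurableSpace (FiltrationState ε S) := ⟨fun _ => trivial⟩

instance : BorelSpace (FiltrationState ε S) := ⟨borel_eq_top_of_discrete.symm⟩

end FiltrationState

variable {ε : ℚ≥0} {S : Set Formula}

/-- The transition measure of the filtration at a state: the image of a measure representing
the rates of a saturated set in that state. -/
noncomputable def filtrationMeasure (hS : S.Finite) (w : FiltrationState ε S) :
    Measure (FiltrationState ε S) :=
  (w.out.2.exists_measure_real_eq_rate hS).choose.map (FiltrationState.mk S)

instance (hS : S.Finite) (w : FiltrationState ε S) : IsFiniteMeasure (filtrationMeasure hS w) :=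
  have := (w.out.2.exists_measure_real_eq_rate hS).choose_spec.1
  Measure.isFiniteMeasure_map _ _

theorem filtrationMeasure_real_eq_rate (hS : S.Finite) (w : FiltrationState ε S) {ψ : Formula}
    (hψ : ψ ∈ S) {A : Set (FiltrationState ε S)}
    (hA : ∀ Δ, FiltrationState.mk S Δ ∈ A ↔ ψ ∈ Δ.1) :
    (filtrationMeasure hS w).real A = rate ε w.out.1 ψ := by
  rw [filtrationMeasure, map_measureReal_apply .of_discrete .of_discrete, preimage,
    ← (w.out.2.exists_measure_real_eq_rate hS).choose_spec.2 ψ hψ]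
  simp only [hA]

/-- The filtration of the space of saturated sets through a finite set of formulae. -/
noncomputable def filtration (ε : ℚ≥0) (hS : S.Finite) : CMK.{0} where
  carrier := FiltrationState ε S
  analytic := by
    have := FiltrationState.finite ε hS
    exact isAnalyticSpace_of_polishSpace _
  θ := ⟨filtrationMeasure hS, .of_discrete⟩
  finite_rate := fun w => inferInstanceAs (IsFiniteMeasure (filtrationMeasure hS w))

/-- The subformulae of a formula, itself included. -/
def Formula.subformulas : Formula → Set Formula
  | top => {top}
  | neg φ => insert φ.neg φ.subformulas
  | and φ ψ => insert (φ.and ψ) (φ.subformulas ∪ ψ.subformulas)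
  | L r φ => insert (L r φ) φ.subformulas

theorem Formula.self_mem_subformulas (φ : Formula) : φ ∈ φ.subformulas := by
  cases φ <;> simp [subformulas]

theorem Formula.finite_subformulas (φ : Formula) : φ.subformulas.Finite := by
  induction φ <;> simp_all [subformulas]

theorem filtration_sat_mk_iff (hS : S.Finite) {φ : Formula} (hφ : φ.subformulas ⊆ S)
    (Γ : SaturatedSet ε) : (filtration ε hS).Sat ε φ (FiltrationState.mk S Γ) ↔ φ ∈ Γ.1 := by
  induction φ generalizing Γ with
  | top => exact iff_of_true trivial (Γ.2.mem_of_provable (.taut fun _ => trivial))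
  | neg φ ih =>
    exact (not_congr (ih ((subset_insert _ _).trans hφ) Γ)).trans Γ.2.neg_mem_iff.symm
  | and φ ψ ih₁ ih₂ =>
    obtain ⟨hφ, hψ⟩ := union_subset_iff.1 ((subset_insert _ _).trans hφ)
    exact (and_congr (ih₁ hφ Γ) (ih₂ hψ Γ)).trans Γ.2.and_mem_iff.symm
  | L r φ ih =>
    have hsub : φ.subformulas ⊆ S := (subset_insert _ _).trans hφ
    have hrate : ((filtration ε hS).θ (FiltrationState.mk S Γ)).real
        {n | (filtration ε hS).Sat ε φ n} = rate ε (FiltrationState.mk S Γ).out.1 φ :=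
      filtrationMeasure_real_eq_rate hS _ (hsub φ.self_mem_subformulas) fun Δ => ih hsub Δ
    change (r : ℝ) ≤ ((filtration ε hS).θ (FiltrationState.mk S Γ)).real _ + ε ↔ _
    rw [hrate, ← (FiltrationState.mk S Γ).out.2.L_mem_iff_le_rate,
      FiltrationState.mem_out_mk_iff Γ (hφ (L r φ).self_mem_subformulas)]

end Filtration

end CML

theorem mainTheorem8 (ε : ℚ≥0) (φ : CML.Formula) (hφ : CML.Consistent ε φ) :
    ∃ M : CML.CMK.{0}, Finite M.carrier ∧ ∃ m : M.carrier, M.Sat ε φ m := by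
  obtain ⟨Γ, hΓ, hφΓ⟩ := hφ.exists_isSaturated
  exact ⟨CML.filtration ε φ.finite_subformulas,
    CML.FiltrationState.finite ε φ.finite_subformulas, .mk φ.subformulas ⟨Γ, hΓ⟩,
    (CML.filtration_sat_mk_iff φ.finite_subformulas subset_rfl _).2 hφΓ⟩
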